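/- A dimension function is a function $h:[0,\infty)\to[0,\infty)$ that is non-decreasing and right-continuous, with $h(0)=0$ and $h(t)>0$ for $t>0$. Its Hausdorff measure is $$\mathcal H^h(E)=\lim_{\delta\to0}\ \inf\Big\{\sum_i h(\operatorname{diam} U_i)\ :\ E\subseteq\bigcup_i U_i \text{ a countable covering with } \operatorname{diam} U_i\le\delta \text{ for all } i\Big\}.$$ Let $d\in\mathbb N$ and let $h$ be a dimension function with $h\prec x^d$, that is, $\lim_{x\to0^+}x^d/h(x)=0$. Let $(\alpha_n)_{n\in\mathbb N}$ be a sequence of non-zero real numbers. Then there is a compact set $E\subseteq\mathbb R^d$ with $\mathcal H^h(E)>0$ such that, for every $n$, $E$ does not contain the vertices of any trapezoid whose parallel sides have lengths in proportion $|\alpha_n|$; that is, there are no four distinct points $A,B,C,D\in E$ such that the lines $AB$ and $CD$ are parallel (possibly equal, so that degenerate trapezoids with collinear vertices are also excluded) and $|A-B|=|\alpha_n|\,|C-D|$. -/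

import Mathlib

open Set Filter Topology
open scoped NNReal ENNReal

/-- Dimension functions: `h : [0,∞) → [0,∞)` with `h 0 = 0`, `h t > 0` for `t > 0`,
(weakly) increasing and right-continuous. -/
structure IsDimensionFunction (h : ℝ≥0 → ℝ≥0) : Prop where
  zero : h 0 = 0
  pos : ∀ t, 0 < t → 0 < h t
  mono : Monotone h
  rightCont : ∀ t, ContinuousWithinAt h (Ici t) t

/-- The relation `h₂ ≺ h₁`, that is, `h₁ x / h₂ x → 0` as `x → 0⁺`. -/
def DimPrec (h₂ h₁ : ℝ≥0 → ℝ≥0) : Prop :=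
  Tendsto (fun x => h₁ x / h₂ x) (𝓝[>] 0) (𝓝 0)

/-- The Hausdorff measure associated with `h`: the limit as `δ → 0` of the infimum of
`∑ i, h (diam (U i))` over countable coverings by sets of diameter at most `δ`.
(The value given to sets of infinite diameter is immaterial.) -/
noncomputable def dimHausdorffMeasure {X : Type*} [EMetricSpace X] [MeasurableSpace X]
    [BorelSpace X] (h : ℝ≥0 → ℝ≥0) : MeasureTheory.Measure X :=
  MeasureTheory.Measure.mkMetric (fun r : ℝ≥0∞ => (h r.toNNReal : ℝ≥0∞))

/-- `A, B, C, D` are the vertices of a trapezoid whose sides `AB` and `CD` are parallel: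
four distinct points such that the lines `AB` and `CD` are parallel. The degenerate case in
which the two lines coincide is included. -/
structure IsTrapezoid {V : Type*} [NormedAddCommGroup V] [NormedSpace ℝ V]
    (A B C D : V) : Prop where
  distinct : [A, B, C, D].Nodup
  parallel : (line[ℝ, A, B]).Parallel line[ℝ, C, D]

open MeasureTheory

/-! A trapezoid with ratio `b` gives `A - B = t (C - D)` with `t = ±b`, and a mismatch of lattices
rules this out. In a Cantor construction, let the new corners near `A` lie on `u ℤ + u / 2`, near
`B` on `u ℤ`, and elsewhere on `(u / b) ℤ`, coordinatewise. Then `A - B` is near `u ℤ + u / 2` and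
`t (C - D)` is near `u ℤ`, with total error at most `u / 4` if the new cubes are small enough
(`limitPoint_sub_ne`). Each stage treats one ratio and one pair of balls isolating `A` and `B`.
Every such choice recurs infinitely often, so it is met at a stage so late that the corners already
lie on the correct sides of the balls.

The lattices cost a factor depending only on `b` in the side length, while the number `M + 1` of
subcubes per direction is free. Hence the mass of a set of diameter `r` is at most `(5 r / density)
^ d`, with `density` independent of `M`. As `h ≺ x ^ d`, this is below `h r` once `r` is small, and
a large `M` ensures that the bound is only used for such `r`. Mass distribution then gives positive
measure. -/

/-- A countable type has an enumeration in which every element occurs infinitely often. -/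
theorem exists_forall_frequently_eq (T : Type*) [Denumerable T] :
    ∃ t : ℕ → T, ∀ a, ∃ᶠ k in atTop, t k = a := by
  refine ⟨fun k => Denumerable.ofNat T k.unpair.1, fun a => ?_⟩
  rw [Nat.frequently_atTop_iff_infinite]
  refine Set.infinite_of_injective_forall_mem
    (f := fun c : ℕ => Nat.pair (Encodable.encode a) c) (fun c c' hc => ?_) fun c => ?_
  · exact (Nat.pair_eq_pair.1 hc).2
  · simp

/-- There are sequences of indices and of pairs of sets such that any index, paired with some
separation of a point `A` and a point `B` from each other and from `C` and `D`, occurs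
infinitely often. -/
theorem exists_frequently_separating (X : Type*) [MetricSpace X]
    [TopologicalSpace.SeparableSpace X] [Nonempty X] :
    ∃ (m : ℕ → ℕ) (U V : ℕ → Set X), ∀ (n : ℕ) (A B C D : X),
      A ≠ B → A ≠ C → A ≠ D → B ≠ C → B ≠ D →
      ∃ U₀ V₀ : Set X, U₀ ∈ 𝓝 A ∧ U₀ᶜ ∈ 𝓝 B ∧ U₀ᶜ ∈ 𝓝 C ∧ U₀ᶜ ∈ 𝓝 D ∧
        V₀ ∈ 𝓝 B ∧ V₀ᶜ ∈ 𝓝 C ∧ V₀ᶜ ∈ 𝓝 D ∧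
        ∃ᶠ k in atTop, m k = n ∧ U k = U₀ ∧ V k = V₀ := by
  let x := TopologicalSpace.denseSeq X
  obtain ⟨t, ht⟩ := exists_forall_frequently_eq (ℕ × ℕ × ℕ × ℕ)
  refine ⟨fun k => (t k).1,
    fun k => Metric.ball (x (t k).2.1) (1 / ((t k).2.2.2 + 1)),
    fun k => Metric.ball (x (t k).2.2.1) (1 / ((t k).2.2.2 + 1)), ?_⟩
  intro n A B C D hAB hAC hAD hBC hBD
  set ρ := min (dist A B) (min (min (dist A C) (dist A D)) (min (dist B C) (dist B D)))
  have hρ0 : 0 < ρ := by simp [ρ, dist_pos, *]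
  obtain ⟨l, hl⟩ := exists_nat_one_div_lt (show 0 < ρ / 2 by positivity)
  have hl0 : (0 : ℝ) < 1 / (l + 1) := by positivity
  obtain ⟨i, hi⟩ := (TopologicalSpace.denseRange_denseSeq X).exists_dist_lt A hl0
  obtain ⟨j, hj⟩ := (TopologicalSpace.denseRange_denseSeq X).exists_dist_lt B hl0
  have key : ∀ (P Q : X) (z : X), ρ ≤ dist P Q → dist P z < 1 / ((l : ℝ) + 1) →
      (Metric.ball z (1 / ((l : ℝ) + 1)))ᶜ ∈ 𝓝 Q := by
    intro P Q z h1 h2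
    have h3 : 1 / ((l : ℝ) + 1) < dist Q z := by
      have := dist_triangle_right P Q z
      linarith
    filter_upwards [(isOpen_lt continuous_const (continuous_id.dist continuous_const)).mem_nhds h3]
      with y hy
    simp only [mem_compl_iff, Metric.mem_ball, not_lt]
    exact le_of_lt hy
  refine ⟨Metric.ball (x i) (1 / (l + 1)), Metric.ball (x j) (1 / (l + 1)),
    Metric.isOpen_ball.mem_nhds hi, key A B _ ?_ hi, key A C _ ?_ hi, key A D _ ?_ hi,
    Metric.isOpen_ball.mem_nhds hj, key B C _ ?_ hj, key B D _ ?_ hj, ?_⟩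
  any_goals simp [ρ]
  refine (ht (n, i, j, l)).mono fun k hk => ?_
  simp [hk]

/-- If `AB` and `CD` are parallel and `|A - B| = r |C - D|`, then `A - B = t (C - D)` with
`|t| = r`. -/
theorem IsTrapezoid.exists_smul_sub_eq {V : Type*} [NormedAddCommGroup V] [NormedSpace ℝ V]
    {A B C D : V} (h : IsTrapezoid A B C D) {r : ℝ}
    (hdist : dist A B = r * dist C D) : ∃ t : ℝ, |t| = r ∧ A - B = t • (C - D) := by
  have hCD : C ≠ D := by
    have := h.distinct
    simp at this
    tauto
  have h1 := AffineSubspace.affineSpan_pair_parallel_iff_vectorSpan_eq.1 h.parallel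
  have h2 : A - B ∈ vectorSpan ℝ ({C, D} : Set V) := by
    rw [← h1]
    exact vsub_mem_vectorSpan ℝ (by simp) (by simp)
  rw [vectorSpan_pair, vsub_eq_sub, Submodule.mem_span_singleton] at h2
  obtain ⟨t, ht⟩ := h2
  refine ⟨t, ?_, ht.symm⟩
  rw [dist_eq_norm, dist_eq_norm, ← ht, norm_smul, Real.norm_eq_abs] at hdist
  exact mul_right_cancel₀ (norm_ne_zero_iff.2 (sub_ne_zero.2 hCD)) hdist

/-! ### The Cantor construction -/

/-- The data of a Cantor-type construction in `ℝ^d`: at stage `k`, each cube is replaced by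
`(M k + 1) ^ d` smaller cubes whose corners lie on a lattice which depends on whether
the old corner is in `U k`, in `V k`, or in neither of them. -/
structure CantorData (d : ℕ) where
  b : ℕ → ℝ
  b_pos : ∀ k, 0 < b k
  U : ℕ → Set (Fin d → ℝ)
  V : ℕ → Set (Fin d → ℝ)
  M : ℕ → ℕ

namespace CantorData

variable {d : ℕ} (S : CantorData d)

/-- The side length of the cubes of stage `k`. -/
noncomputable def side : ℕ → ℝ
  | 0 => 1
  -- The factor `min 1 b` lets both spacings, `unit` and `unit / b`, fit in the old cube; `4 * (1 +
  -- b)` gives `side (k + 1) * (1 + b) = unit / 4`, the error allowed in `limitPoint_sub_ne`.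
  | k + 1 => side k * (min 1 (S.b k) / (4 * (1 + S.b k))) / (4 * (S.M k + 1))

/-- The basic lattice spacing for the corners of the cubes of stage `k + 1`. -/
noncomputable def unit (k : ℕ) : ℝ := S.side k * min 1 (S.b k) / (4 * (S.M k + 1))

open Classical in
/-- The spacing of the lattice used in a cube of stage `k` with corner `q`. -/
noncomputable def spacing (k : ℕ) (q : Fin d → ℝ) : ℝ :=
  if q ∈ S.U k ∪ S.V k then S.unit k else S.unit k / S.b k

open Classical in
/-- The offset of the lattice used in a cube of stage `k` with corner `q`. -/
noncomputable def offset (k : ℕ) (q : Fin d → ℝ) : ℝ :=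
  if q ∈ S.U k then S.unit k / 2 else 0

/-- The corner of the subcube with index `v` of a cube of stage `k` with corner `q`. -/
noncomputable def child (k : ℕ) (q : Fin d → ℝ) (v : Fin d → Fin (S.M k + 1)) : Fin d → ℝ :=
  fun i => S.spacing k q * (⌈q i / S.spacing k q⌉ + (v i : ℕ)) + S.offset k q

/-- Sequences of indices of subcubes. -/
abbrev Code : Type := ∀ k, Fin d → Fin (S.M k + 1)

/-- The corner of the cube of stage `k` given by a sequence of indices. -/
noncomputable def corner (ω : S.Code) : ℕ → Fin d → ℝ
  | 0 => 0
  | k + 1 => S.child k (corner ω k) (ω k)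

/-- The point given by a sequence of indices. -/
noncomputable def limitPoint (ω : S.Code) : Fin d → ℝ := fun i => ⨆ k, S.corner ω k i

/-! ### Sizes and nesting of the cubes -/

theorem side_pos (k : ℕ) : 0 < S.side k := by
  induction k with
  | zero => simp [side]
  | succ k ih =>
    have := S.b_pos k
    rw [side]
    positivity

theorem unit_pos (k : ℕ) : 0 < S.unit k := by
  have := S.b_pos k
  have := S.side_pos k
  rw [unit]
  positivity

theorem side_succ (k : ℕ) : S.side (k + 1) = S.unit k / (4 * (1 + S.b k)) := by
  rw [side, unit]
  have := S.b_pos k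
  field_simp

theorem spacing_pos (k : ℕ) (q : Fin d → ℝ) : 0 < S.spacing k q := by
  have := S.b_pos k
  have := S.unit_pos k
  unfold spacing
  split_ifs <;> positivity

/-- Keeps the interiors of sibling cubes disjoint. -/
theorem side_succ_le_spacing (k : ℕ) (q : Fin d → ℝ) : S.side (k + 1) ≤ S.spacing k q := by
  have hb := S.b_pos k
  have hu := S.unit_pos k
  rw [side_succ]
  unfold spacing
  split_ifs
  · exact div_le_self hu.le (by linarith)
  · exact div_le_div_of_nonneg_left hu.le hb (by linarith)

theorem unit_le (k : ℕ) : S.unit k ≤ S.side k / (4 * (S.M k + 1)) := by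
  rw [unit]
  have := S.side_pos k
  gcongr
  exact mul_le_of_le_one_right this.le (min_le_left _ _)

theorem unit_div_le (k : ℕ) : S.unit k / S.b k ≤ S.side k / (4 * (S.M k + 1)) := by
  have hb := S.b_pos k
  have := S.side_pos k
  rw [div_le_iff₀ hb, unit, div_mul_eq_mul_div]
  gcongr
  exact min_le_right _ _

theorem spacing_le (k : ℕ) (q : Fin d → ℝ) :
    S.spacing k q ≤ S.side k / (4 * (S.M k + 1)) := by
  unfold spacing
  split_ifs
  · exact S.unit_le k
  · exact S.unit_div_le k

theorem offset_nonneg (k : ℕ) (q : Fin d → ℝ) : 0 ≤ S.offset k q := by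
  have := S.unit_pos k
  unfold offset
  split_ifs <;> positivity

theorem offset_le (k : ℕ) (q : Fin d → ℝ) : S.offset k q ≤ S.unit k / 2 := by
  have := S.unit_pos k
  unfold offset
  split_ifs
  · exact le_rfl
  · positivity

theorem side_succ_le (k : ℕ) : S.side (k + 1) ≤ S.side k / (S.M k + 1) / 4 := by
  have h1 := S.side_succ_le_spacing k 0
  have h2 := S.spacing_le k 0
  have h3 : S.side k / (S.M k + 1) / 4 = S.side k / (4 * (S.M k + 1)) := by
    rw [div_div, mul_comm]
  linarith

theorem side_succ_le_half (k : ℕ) : S.side (k + 1) ≤ S.side k / 2 := by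
  have h1 := S.side_succ_le k
  have h2 : S.side k / (S.M k + 1) ≤ S.side k :=
    div_le_self (S.side_pos k).le (by linarith [(S.M k).cast_nonneg (α := ℝ)])
  have := S.side_pos k
  linarith

theorem side_le_one (k : ℕ) : S.side k ≤ 1 := by
  induction k with
  | zero => simp [side]
  | succ k ih =>
    have := S.side_succ_le_half k
    have := S.side_pos k
    linarith

theorem side_antitone : Antitone S.side :=
  antitone_nat_of_succ_le fun k => by
    have := S.side_succ_le_half k
    have := S.side_pos k
    linarith

theorem side_le_pow (k : ℕ) : S.side k ≤ (1 / 2) ^ k := by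
  induction k with
  | zero => simp [side]
  | succ k ih =>
    have := S.side_succ_le_half k
    rw [pow_succ]
    linarith

theorem tendsto_side : Tendsto S.side atTop (𝓝 0) :=
  squeeze_zero (fun k => (S.side_pos k).le) S.side_le_pow
    (tendsto_pow_atTop_nhds_zero_of_lt_one (by norm_num) (by norm_num))

theorem le_child (k : ℕ) (q : Fin d → ℝ) (v : Fin d → Fin (S.M k + 1)) (i : Fin d) :
    q i ≤ S.child k q v i := by
  have hs := S.spacing_pos k q
  have h1 : q i ≤ S.spacing k q * ⌈q i / S.spacing k q⌉ := by
    rw [← div_le_iff₀' hs]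
    exact Int.le_ceil _
  have h2 : 0 ≤ S.spacing k q * (v i : ℕ) := by positivity
  have h3 := S.offset_nonneg k q
  rw [child]
  linarith

/-- Rounding up costs one spacing, the index at most `M`, the offset half a unit and the cube itself
at most one spacing: `M + 5 / 2 ≤ 4 * (M + 1)` in all. -/
theorem child_add_side_le (k : ℕ) (q : Fin d → ℝ) (v : Fin d → Fin (S.M k + 1)) (i : Fin d) :
    S.child k q v i + S.side (k + 1) ≤ q i + S.side k := by
  have hs := S.spacing_pos k q
  set σ := S.side k / (4 * (S.M k + 1)) with hσ
  have hM : (0 : ℝ) ≤ S.M k := by positivity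
  have hσ0 : 0 < σ := by
    have := S.side_pos k
    positivity
  have hσM : S.side k = σ * (4 * (S.M k + 1)) := by
    rw [hσ]
    field_simp
  have h1 : S.spacing k q * ⌈q i / S.spacing k q⌉ ≤ q i + S.spacing k q := by
    have := (Int.ceil_lt_add_one (q i / S.spacing k q)).le
    calc S.spacing k q * ⌈q i / S.spacing k q⌉
        ≤ S.spacing k q * (q i / S.spacing k q + 1) := by gcongr
      _ = _ := by field_simp
  have hle := S.spacing_le k q
  have h2 : S.spacing k q * (v i : ℕ) ≤ σ * S.M k := by
    have : ((v i : ℕ) : ℝ) ≤ S.M k := by exact_mod_cast Nat.lt_succ_iff.1 (v i).2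
    gcongr
  have h3 := S.offset_le k q
  have h4 := S.unit_le k
  have h5 := (S.side_succ_le_spacing k q).trans hle
  rw [child, hσM]
  have := mul_nonneg hσ0.le hM
  linarith

/-! ### Limit points and their dependence on the code -/

theorem corner_le_succ (ω : S.Code) (k : ℕ) (i : Fin d) :
    S.corner ω k i ≤ S.corner ω (k + 1) i := S.le_child _ _ _ _

theorem corner_succ_add_side_le (ω : S.Code) (k : ℕ) (i : Fin d) :
    S.corner ω (k + 1) i + S.side (k + 1) ≤ S.corner ω k i + S.side k :=
  S.child_add_side_le _ _ _ _

theorem corner_monotone (ω : S.Code) (i : Fin d) : Monotone fun k => S.corner ω k i :=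
  monotone_nat_of_le_succ fun k => S.corner_le_succ ω k i

theorem corner_add_side_antitone (ω : S.Code) (i : Fin d) :
    Antitone fun k => S.corner ω k i + S.side k :=
  antitone_nat_of_succ_le fun k => S.corner_succ_add_side_le ω k i

theorem corner_le_corner_add_side (ω : S.Code) (i : Fin d) (k l : ℕ) :
    S.corner ω l i ≤ S.corner ω k i + S.side k := by
  have h1 := S.corner_monotone ω i (le_max_left l k)
  have h2 := S.corner_add_side_antitone ω i (le_max_right l k)
  have h3 := S.side_pos (max l k)
  simp only at h1 h2
  linarith

theorem corner_le_limitPoint (ω : S.Code) (k : ℕ) (i : Fin d) :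
    S.corner ω k i ≤ S.limitPoint ω i :=
  le_ciSup (f := fun k => S.corner ω k i)
    ⟨S.corner ω 0 i + S.side 0, by rintro _ ⟨l, rfl⟩; exact S.corner_le_corner_add_side ω i 0 l⟩ k

theorem limitPoint_le (ω : S.Code) (k : ℕ) (i : Fin d) :
    S.limitPoint ω i ≤ S.corner ω k i + S.side k :=
  ciSup_le fun l => S.corner_le_corner_add_side ω i k l

theorem dist_corner_limitPoint_le (ω : S.Code) (k : ℕ) :
    dist (S.limitPoint ω) (S.corner ω k) ≤ S.side k := by
  refine (dist_pi_le_iff (S.side_pos k).le).2 fun i => ?_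
  have h1 := S.corner_le_limitPoint ω k i
  have h2 := S.limitPoint_le ω k i
  rw [Real.dist_eq, abs_le]
  constructor <;> linarith [S.side_pos k]

theorem tendsto_corner (ω : S.Code) : Tendsto (S.corner ω) atTop (𝓝 (S.limitPoint ω)) := by
  rw [tendsto_iff_dist_tendsto_zero]
  refine squeeze_zero (fun k => dist_nonneg) (fun k => ?_) S.tendsto_side
  rw [dist_comm]
  exact S.dist_corner_limitPoint_le ω k

theorem isLocallyConstant_corner (k : ℕ) : IsLocallyConstant fun ω : S.Code => S.corner ω k := by
  induction k with
  | zero => exact IsLocallyConstant.const _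
  | succ k ih =>
    have h : IsLocallyConstant fun ω : S.Code => ω k :=
      (IsLocallyConstant.of_discrete id).comp_continuous
        (continuous_apply (A := fun k => Fin d → Fin (S.M k + 1)) k)
    exact ih.comp₂ h (S.child k)

theorem continuous_limitPoint : Continuous S.limitPoint := by
  have : TendstoUniformly (fun k (ω : S.Code) => S.corner ω k) S.limitPoint atTop := by
    rw [Metric.tendstoUniformly_iff]
    intro ε hε
    filter_upwards [S.tendsto_side.eventually_lt_const hε] with k hk ω
    exact (S.dist_corner_limitPoint_le ω k).trans_lt hk
  exact this.continuous (Frequently.of_forall fun k => (S.isLocallyConstant_corner k).continuous)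

theorem corner_congr {ω ω' : S.Code} {k : ℕ} (h : ∀ j < k, ω j = ω' j) :
    S.corner ω k = S.corner ω' k := by
  induction k with
  | zero => rfl
  | succ k ih =>
    rw [corner, corner, ih fun j hj => h j (by omega), h k (by omega)]

/-- By nesting, close corners have close parents, so inductively the parents agree; siblings with
different indices are at least one spacing apart in some coordinate. -/
theorem eq_of_abs_corner_sub_lt {ω ω' : S.Code} {k : ℕ}
    (h : ∀ i, |S.corner ω k i - S.corner ω' k i| < S.side k) : ∀ j < k, ω j = ω' j := by
  induction k with
  | zero => intro j hj; omega
  | succ k ih =>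
    have h0 : ∀ j < k, ω j = ω' j := by
      refine ih fun i => ?_
      have h1 := abs_lt.1 (h i)
      have h2 := S.corner_le_succ ω k i
      have h3 := S.corner_le_succ ω' k i
      have h4 := S.corner_succ_add_side_le ω k i
      have h5 := S.corner_succ_add_side_le ω' k i
      rw [abs_lt]
      constructor <;> linarith
    have hc := S.corner_congr h0
    intro j hj
    rcases Nat.lt_succ_iff_lt_or_eq.1 hj with hj | rfl
    · exact h0 j hj
    · funext i
      have h1 := h i
      rw [corner, corner, hc, child, child] at h1
      set s := S.spacing j (S.corner ω' j)
      have hs : 0 < s := S.spacing_pos _ _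
      have h2 := S.side_succ_le_spacing j (S.corner ω' j)
      have h3 : |s * (((ω j i : ℕ) : ℝ) - (ω' j i : ℕ))| < s := by
        refine lt_of_eq_of_lt ?_ (h1.trans_le h2)
        congr 1
        ring
      rw [abs_mul, abs_of_pos hs] at h3
      have h4 : |((ω j i : ℕ) : ℝ) - (ω' j i : ℕ)| < 1 := by
        by_contra! h5
        nlinarith
      have h5 : |((ω j i : ℕ) : ℤ) - (ω' j i : ℕ)| < 1 := by exact_mod_cast h4
      rw [Int.abs_lt_one_iff] at h5
      exact Fin.ext (by omega)

/-! ### Exclusion of trapezoids by lattice mismatch -/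

/-- The lattices of a stage exclude `A - B = t (C - D)` when the corner of the cube of `A` is
in `U k`, the corner of the cube of `B` is in `V k` only, and those of `C`, `D` are in neither. -/
theorem limitPoint_sub_ne (k : ℕ) {ωA ωB ωC ωD : S.Code}
    (hA : S.corner ωA k ∈ S.U k) (hB : S.corner ωB k ∉ S.U k) (hB' : S.corner ωB k ∈ S.V k)
    (hC : S.corner ωC k ∉ S.U k) (hC' : S.corner ωC k ∉ S.V k)
    (hD : S.corner ωD k ∉ S.U k) (hD' : S.corner ωD k ∉ S.V k) {t : ℝ} (ht : |t| = S.b k)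
    (i : Fin d) : S.limitPoint ωA i - S.limitPoint ωB i ≠
      t * (S.limitPoint ωC i - S.limitPoint ωD i) := by
  intro heq
  have hb := S.b_pos k
  set ε := S.unit k with hε
  have hε0 : 0 < ε := S.unit_pos k
  have hδ : S.side (k + 1) * (1 + S.b k) = ε / 4 := by
    rw [side_succ, ← hε]
    field_simp
  obtain ⟨a, ha⟩ : ∃ a : ℤ, S.corner ωA (k + 1) i = ε * a + ε / 2 :=
    ⟨⌈S.corner ωA k i / ε⌉ + (ωA k i : ℕ), by simp [corner, child, spacing, offset, hA, ε]⟩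
  obtain ⟨b, hb'⟩ : ∃ b : ℤ, S.corner ωB (k + 1) i = ε * b :=
    ⟨⌈S.corner ωB k i / ε⌉ + (ωB k i : ℕ), by simp [corner, child, spacing, offset, hB, hB', ε]⟩
  obtain ⟨c, hc⟩ : ∃ c : ℤ, S.corner ωC (k + 1) i = ε / S.b k * c :=
    ⟨⌈S.corner ωC k i / (ε / S.b k)⌉ + (ωC k i : ℕ), by
      simp [corner, child, spacing, offset, hC, hC', ε]⟩
  obtain ⟨e, he⟩ : ∃ e : ℤ, S.corner ωD (k + 1) i = ε / S.b k * e :=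
    ⟨⌈S.corner ωD k i / (ε / S.b k)⌉ + (ωD k i : ℕ), by
      simp [corner, child, spacing, offset, hD, hD', ε]⟩
  -- Since `t = ±b`, multiplication by `t` maps `(ε / b) ℤ` into `ε ℤ`.
  obtain ⟨z, hz⟩ : ∃ z : ℤ, t * (ε / S.b k * c - ε / S.b k * e) = ε * z := by
    rcases eq_or_eq_neg_of_abs_eq ht with rfl | rfl
    · exact ⟨c - e, by push_cast; field_simp⟩
    · exact ⟨e - c, by push_cast; field_simp; ring⟩
  have hA1 := S.corner_le_limitPoint ωA (k + 1) i
  have hA2 := S.limitPoint_le ωA (k + 1) i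
  have hB1 := S.corner_le_limitPoint ωB (k + 1) i
  have hB2 := S.limitPoint_le ωB (k + 1) i
  have hC1 := S.corner_le_limitPoint ωC (k + 1) i
  have hC2 := S.limitPoint_le ωC (k + 1) i
  have hD1 := S.corner_le_limitPoint ωD (k + 1) i
  have hD2 := S.limitPoint_le ωD (k + 1) i
  have h1 : |(S.limitPoint ωA i - ε * a - ε / 2) - (S.limitPoint ωB i - ε * b)| ≤
      S.side (k + 1) := by
    rw [abs_le]
    constructor <;> linarith
  have h2 : |t * ((S.limitPoint ωC i - ε / S.b k * c) - (S.limitPoint ωD i - ε / S.b k * e))| ≤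
      S.b k * S.side (k + 1) := by
    rw [abs_mul, ht]
    refine mul_le_mul_of_nonneg_left ?_ hb.le
    rw [abs_le]
    constructor <;> linarith
  have h3 : |ε * ((b + z - a : ℤ) - 1 / 2 : ℝ)| ≤ ε / 4 := by
    calc |ε * ((b + z - a : ℤ) - 1 / 2 : ℝ)|
        = |((S.limitPoint ωA i - ε * a - ε / 2) - (S.limitPoint ωB i - ε * b)) -
            t * ((S.limitPoint ωC i - ε / S.b k * c) -
              (S.limitPoint ωD i - ε / S.b k * e))| := by
          congr 1
          push_cast
          linear_combination -heq - hz
      _ ≤ S.side (k + 1) + S.b k * S.side (k + 1) := (abs_sub _ _).trans (add_le_add h1 h2)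
      _ = ε / 4 := by rw [← hδ]; ring
  rw [abs_mul, abs_of_pos hε0] at h3
  have h4 : |((b + z - a : ℤ) - 1 / 2 : ℝ)| ≤ 1 / 4 := by
    by_contra! h5
    nlinarith
  -- An integer within `1 / 4` of `1 / 2` would lie strictly between 0 and 1.
  obtain ⟨h5, h6⟩ := abs_le.1 h4
  have h7 : (0 : ℝ) < ((b + z - a : ℤ) : ℝ) := by linarith
  have h8 : ((b + z - a : ℤ) : ℝ) < 1 := by linarith
  have h9 : 0 < b + z - a := by exact_mod_cast h7
  have h10 : b + z - a < 1 := by exact_mod_cast h8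
  omega

/-! ### The natural measure and its mass bound -/

/-- The uniform measure on sequences of indices. -/
noncomputable def codeMeasure : Measure S.Code :=
  Measure.infinitePi fun k => (PMF.uniformOfFintype (Fin d → Fin (S.M k + 1))).toMeasure

instance : IsProbabilityMeasure S.codeMeasure := by
  unfold codeMeasure
  infer_instance

/-- The density of the cubes of stage `k`. -/
noncomputable def density (b : ℕ → ℝ) (k : ℕ) : ℝ :=
  ∏ j ∈ Finset.range k, min 1 (b j) / (4 * (1 + b j)) / 4

theorem density_pos {b : ℕ → ℝ} (hb : ∀ k, 0 < b k) (k : ℕ) : 0 < density b k :=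
  Finset.prod_pos fun j _ => by
    have := hb j
    positivity

theorem side_div_density (k : ℕ) :
    S.side k / density S.b k = ∏ j ∈ Finset.range k, ((S.M j : ℝ) + 1)⁻¹ := by
  induction k with
  | zero => simp [density, side]
  | succ k ih =>
    have h1 := density_pos S.b_pos k
    have hb := S.b_pos k
    have h2 : 0 < min 1 (S.b k) := lt_min one_pos hb
    rw [Finset.prod_range_succ, ← ih, side, density, Finset.prod_range_succ]
    change _ / (density S.b k * _) = _
    field_simp

theorem codeMeasure_cylinder (ω : S.Code) (k : ℕ) :
    S.codeMeasure {ω' | ∀ j < k, ω' j = ω j} =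
      ENNReal.ofReal ((S.side k / density S.b k) ^ d) := by
  have h1 : {ω' : S.Code | ∀ j < k, ω' j = ω j} =
      Set.pi (Finset.range k : Set ℕ) fun j => {ω j} := by
    ext
    simp
  rw [h1, codeMeasure, Measure.infinitePi_pi _ (fun _ _ => measurableSet_singleton _),
    S.side_div_density, ← Finset.prod_pow,
    ENNReal.ofReal_prod_of_nonneg fun _ _ => by positivity]
  refine Finset.prod_congr rfl fun j _ => ?_
  rw [PMF.toMeasure_apply_singleton _ _ (measurableSet_singleton _),
    PMF.uniformOfFintype_apply]
  simp only [Fintype.card_pi, Fintype.card_fin, Finset.prod_const, Finset.card_univ]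
  rw [inv_pow, ENNReal.ofReal_inv_of_pos (by positivity), ENNReal.ofReal_pow (by positivity)]
  congr 2
  push_cast
  norm_cast

/-- Cells of a grid of mesh `side k` contain at most one stage-`k` corner each, and at most `5 * r /
side k` cells per direction are relevant. -/
theorem codeMeasure_preimage_le {T : Set (Fin d → ℝ)} {r : ℝ}
    (hT : ∀ x ∈ T, ∀ y ∈ T, ∀ i, |x i - y i| ≤ r) {k : ℕ} (hr : S.side k ≤ r) :
    S.codeMeasure (S.limitPoint ⁻¹' T) ≤ ENNReal.ofReal ((5 * r / density S.b k) ^ d) := by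
  rcases (S.limitPoint ⁻¹' T).eq_empty_or_nonempty with h0 | ⟨ω₀, hω₀⟩
  · simp [h0]
  set δ := S.side k with hδ
  have hδ0 : 0 < δ := S.side_pos k
  have hr0 : 0 < r := hδ0.trans_le hr
  have hc := density_pos S.b_pos k
  set x := S.limitPoint ω₀ with hx
  set F : S.Code → Fin d → ℤ := fun ω i => ⌊S.corner ω k i / δ⌋ with hF
  set I : Fin d → Finset ℤ := fun i => Finset.Icc ⌊(x i - r - δ) / δ⌋ ⌊(x i + r) / δ⌋ with hI
  have hcover : S.limitPoint ⁻¹' T ⊆ ⋃ z ∈ Fintype.piFinset I, {ω | F ω = z} := by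
    intro ω hω
    simp only [mem_iUnion, mem_ofPred_eq, exists_prop, exists_eq_right', Fintype.mem_piFinset]
    intro i
    have h1 := abs_le.1 (hT _ hω _ hω₀ i)
    have h2 := S.corner_le_limitPoint ω k i
    have h3 := S.limitPoint_le ω k i
    rw [hI, Finset.mem_Icc]
    constructor
    · refine Int.floor_le_floor ?_
      gcongr
      linarith
    · refine Int.floor_le_floor ?_
      gcongr
      linarith
  have hfib : ∀ z, S.codeMeasure {ω | F ω = z} ≤
      ENNReal.ofReal ((δ / density S.b k) ^ d) := by
    intro z
    rcases {ω | F ω = z}.eq_empty_or_nonempty with h0 | ⟨ω₁, hω₁⟩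
    · simp [h0]
    rw [← S.codeMeasure_cylinder ω₁ k]
    refine measure_mono fun ω hω => S.eq_of_abs_corner_sub_lt fun i => ?_
    have h1 : ⌊S.corner ω k i / δ⌋ = ⌊S.corner ω₁ k i / δ⌋ := by
      have : F ω = F ω₁ := hω.trans hω₁.symm
      exact congrFun this i
    have h2 := Int.abs_sub_lt_one_of_floor_eq_floor h1
    rw [← sub_div, abs_div, abs_of_pos hδ0, div_lt_one hδ0] at h2
    exact h2
  have hcard : ((Fintype.piFinset I).card : ℝ) ≤ (5 * r / δ) ^ d := by
    rw [Fintype.card_piFinset]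
    push_cast
    calc ∏ i, ((I i).card : ℝ) ≤ ∏ _i : Fin d, (5 * r / δ) := by
          refine Finset.prod_le_prod (fun _ _ => by positivity) fun i _ => ?_
          have h1 : ⌊(x i - r - δ) / δ⌋ ≤ ⌊(x i + r) / δ⌋ + 1 := by
            have : ⌊(x i - r - δ) / δ⌋ ≤ ⌊(x i + r) / δ⌋ := by
              refine Int.floor_le_floor ?_
              gcongr
              linarith
            omega
          have h2 : ((I i).card : ℤ) = ⌊(x i + r) / δ⌋ + 1 - ⌊(x i - r - δ) / δ⌋ := by
            rw [hI, Int.card_Icc_of_le _ _ h1]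
          have h3 : ((I i).card : ℝ) =
              -- The count is at most `2 r / δ + 3`, and `1 ≤ r / δ` absorbs the 3.
              (⌊(x i + r) / δ⌋ : ℝ) + 1 - (⌊(x i - r - δ) / δ⌋ : ℝ) := by exact_mod_cast h2
          have h4 := Int.floor_le ((x i + r) / δ)
          have h5 := Int.lt_floor_add_one ((x i - r - δ) / δ)
          have h6 : (x i + r) / δ - (x i - r - δ) / δ = 2 * (r / δ) + 1 := by
            field_simp
            ring
          have h7 : 1 ≤ r / δ := by rwa [one_le_div hδ0]
          have h8 : 5 * r / δ = 5 * (r / δ) := by ring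
          rw [h3, h8]
          linarith
      _ = (5 * r / δ) ^ d := by rw [Finset.prod_const, Finset.card_univ, Fintype.card_fin]
  calc S.codeMeasure (S.limitPoint ⁻¹' T)
      ≤ S.codeMeasure (⋃ z ∈ Fintype.piFinset I, {ω | F ω = z}) := measure_mono hcover
    _ ≤ ∑ z ∈ Fintype.piFinset I, S.codeMeasure {ω | F ω = z} := measure_biUnion_finset_le _ _
    _ ≤ (Fintype.piFinset I).card • ENNReal.ofReal ((δ / density S.b k) ^ d) :=
        Finset.sum_le_card_nsmul _ _ _ fun z _ => hfib z
    _ = ENNReal.ofReal ((Fintype.piFinset I).card * (δ / density S.b k) ^ d) := by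
        rw [nsmul_eq_mul, ENNReal.ofReal_mul (by positivity), ENNReal.ofReal_natCast]
    _ ≤ ENNReal.ofReal ((5 * r / δ) ^ d * (δ / density S.b k) ^ d) := by gcongr
    _ = ENNReal.ofReal ((5 * r / density S.b k) ^ d) := by
        rw [← mul_pow]
        congr 2
        field_simp

/-! ### The limit set and its Hausdorff measure -/

/-- The set of all points given by sequences of indices. -/
def limitSet : Set (EuclideanSpace ℝ (Fin d)) := range fun ω => WithLp.toLp 2 (S.limitPoint ω)

theorem continuous_toLp_limitPoint :
    Continuous fun ω => (WithLp.toLp 2 (S.limitPoint ω) : EuclideanSpace ℝ (Fin d)) :=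
  (PiLp.continuous_toLp 2 _).comp S.continuous_limitPoint

theorem isCompact_limitSet : IsCompact S.limitSet :=
  isCompact_range S.continuous_toLp_limitPoint

/-- If the cubes shrink quickly enough, the limit set has positive Hausdorff measure. -/
theorem dimHausdorffMeasure_limitSet_pos {h : ℝ≥0 → ℝ≥0} (hh : IsDimensionFunction h)
    (hS : ∀ k, ∀ r : ℝ≥0, 0 < r → (r : ℝ) ≤ S.side (k + 1) →
      (5 * r / density S.b (k + 2)) ^ d ≤ h r) :
    0 < dimHausdorffMeasure h S.limitSet := by
  set f := fun ω => (WithLp.toLp 2 (S.limitPoint ω) : EuclideanSpace ℝ (Fin d)) with hf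
  have hfm : Measurable f := S.continuous_toLp_limitPoint.measurable
  set μ := S.codeMeasure.map f with hμ
  have hsmall : ∀ (r : ℝ≥0) (s : Set (EuclideanSpace ℝ (Fin d))), 0 < r →
      (r : ℝ) < S.side 1 → Metric.ediam s ≤ r → μ s ≤ h r := by
    intro r s hr0 hr1 hs
    -- The closure is measurable and has the same diameter.
    have hs' : Metric.ediam (closure s) ≤ r := by rwa [Metric.ediam_closure]
    have hex : ∃ k, S.side k ≤ r := by
      have := S.tendsto_side.eventually_lt_const (show (0 : ℝ) < r by exact_mod_cast hr0)
      obtain ⟨k, hk⟩ := this.exists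
      exact ⟨k, hk.le⟩
    classical
    obtain ⟨k, hk, hk'⟩ : ∃ k, S.side (k + 2) ≤ r ∧ r ≤ S.side (k + 1) := by
      have h1 := Nat.find_spec hex
      have h2 : ∀ {m}, m < Nat.find hex → ¬ S.side m ≤ r := Nat.find_min hex
      have h3 : 1 < Nat.find hex := by
        by_contra! h4
        exact absurd ((S.side_antitone h4).trans h1) (not_le.2 hr1)
      obtain ⟨k, hk⟩ := Nat.exists_eq_add_of_lt h3
      refine ⟨k, ?_, (not_le.1 (h2 (m := k + 1) (by omega))).le⟩
      rwa [show k + 2 = Nat.find hex by omega]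
    calc μ s ≤ μ (closure s) := measure_mono subset_closure
      _ = S.codeMeasure (S.limitPoint ⁻¹' (WithLp.toLp 2 ⁻¹' closure s)) := by
          rw [hμ, Measure.map_apply hfm isClosed_closure.measurableSet]
          rfl
      _ ≤ ENNReal.ofReal ((5 * r / density S.b (k + 2)) ^ d) := by
          refine S.codeMeasure_preimage_le ?_ hk
          intro x hx y hy i
          have h1 : edist (WithLp.toLp 2 x : EuclideanSpace ℝ (Fin d)) (WithLp.toLp 2 y) ≤ r :=
            (Metric.edist_le_ediam_of_mem (mem_preimage.1 hx) (mem_preimage.1 hy)).trans hs'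
          rw [edist_nndist] at h1
          have h2 : dist (WithLp.toLp 2 x : EuclideanSpace ℝ (Fin d)) (WithLp.toLp 2 y) ≤ r := by
            rw [dist_nndist]
            exact_mod_cast h1
          rw [dist_eq_norm] at h2
          exact (PiLp.norm_apply_le _ i).trans h2
      _ ≤ ENNReal.ofReal (h r) := ENNReal.ofReal_le_ofReal (hS k r hr0 hk')
      _ = h r := ENNReal.ofReal_coe_nnreal
  have hle : μ ≤ dimHausdorffMeasure h := by
    refine Measure.le_mkMetric _ _ (ENNReal.ofReal (S.side 1 / 2))
      (by simpa using S.side_pos 1) fun s hs => ?_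
    have hfin : Metric.ediam s ≠ ⊤ := ne_top_of_le_ne_top ENNReal.ofReal_ne_top hs
    set r := (Metric.ediam s).toNNReal with hr
    have hrs : Metric.ediam s = r := (ENNReal.coe_toNNReal hfin).symm
    have hr1 : (r : ℝ) < S.side 1 := by
      rw [hrs] at hs
      have h1 : (r : ℝ) ≤ S.side 1 / 2 := by
        have := ENNReal.toReal_mono ENNReal.ofReal_ne_top hs
        rwa [ENNReal.toReal_ofReal (by linarith [S.side_pos 1]), ENNReal.coe_toReal] at this
      linarith [S.side_pos 1]
    -- The diameter may be 0, where the mass bound is unavailable; it is applied to `t > r` and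
    -- right-continuity passes to the limit.
    have h1 : Tendsto (fun t => (h t : ℝ≥0∞)) (𝓝[>] r) (𝓝 (h r)) :=
      ENNReal.tendsto_coe.2 ((hh.rightCont r).mono Ioi_subset_Ici_self)
    refine ge_of_tendsto h1 ?_
    have h2 : ∀ᶠ t : ℝ≥0 in 𝓝[>] r, (t : ℝ) < S.side 1 :=
      nhdsWithin_le_nhds
        ((isOpen_lt NNReal.continuous_coe continuous_const).mem_nhds hr1)
    filter_upwards [h2, self_mem_nhdsWithin] with t ht ht'
    exact hsmall t s (pos_of_gt ht') ht (by rw [hrs]; exact_mod_cast (le_of_lt ht'))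
  refine lt_of_lt_of_le ?_ (hle _)
  have : μ S.limitSet = 1 := by
    rw [hμ, Measure.map_apply hfm S.isCompact_limitSet.isClosed.measurableSet]
    have : f ⁻¹' S.limitSet = univ := by
      ext ω
      simp [limitSet, hf]
    rw [this, measure_univ]
  rw [this]
  exact one_pos

end CantorData

/-! ### Choice of parameters and conclusion -/

/-- If `h ≺ x ^ d`, then `(c x) ^ d ≤ h x` for all small `x`. -/
theorem DimPrec.exists_forall_pow_le {d : ℕ} {h : ℝ≥0 → ℝ≥0} (hh : IsDimensionFunction h)
    (hd : DimPrec h (fun x => x ^ d)) {c : ℝ} (hc : 0 < c) :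
    ∃ η : ℝ, 0 < η ∧ ∀ r : ℝ≥0, 0 < r → (r : ℝ) ≤ η → (5 * r / c) ^ d ≤ h r := by
  have hK : (0 : ℝ) < (c / 5) ^ d := by positivity
  have h1 : ∀ᶠ x in 𝓝[>] (0 : ℝ≥0), x ^ d / h x < Real.toNNReal ((c / 5) ^ d) :=
    hd.eventually_lt_const (Real.toNNReal_pos.2 hK)
  obtain ⟨u, hu, hu'⟩ := mem_nhdsGT_iff_exists_Ioc_subset.1 h1
  refine ⟨u, hu, fun r hr hru => ?_⟩
  have h2 : r ^ d / h r < Real.toNNReal ((c / 5) ^ d) := hu' ⟨hr, by exact_mod_cast hru⟩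
  have hpos : (0 : ℝ) < h r := by exact_mod_cast hh.pos r hr
  have h3 : (r : ℝ) ^ d / h r < (c / 5) ^ d := by
    have := NNReal.coe_lt_coe.2 h2
    rwa [Real.coe_toNNReal _ hK.le, NNReal.coe_div, NNReal.coe_pow] at this
  rw [div_lt_iff₀ hpos, ← div_lt_iff₀' hK, ← div_pow] at h3
  refine le_trans (le_of_eq ?_) h3.le
  congr 1
  field_simp

theorem mainTheorem8 (d : ℕ) (h : ℝ≥0 → ℝ≥0) (hh : IsDimensionFunction h)
    (hd : DimPrec h (fun x => x ^ d)) (α : ℕ → ℝ) (hα : ∀ n, α n ≠ 0) :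
    ∃ E : Set (EuclideanSpace ℝ (Fin d)), IsCompact E ∧
      0 < dimHausdorffMeasure h E ∧
      ∀ n, ∀ A ∈ E, ∀ B ∈ E, ∀ C ∈ E, ∀ D ∈ E,
        IsTrapezoid A B C D → dist A B ≠ |α n| * dist C D := by
  obtain ⟨m, U, V, hsep⟩ := exists_frequently_separating (Fin d → ℝ)
  have hb : ∀ k, 0 < |α (m k)| := fun k => abs_pos.2 (hα _)
  -- No circularity: `density` involves only the ratios, so `η` is fixed before `M`.
  choose η hη0 hη using fun k =>
    hd.exists_forall_pow_le hh (CantorData.density_pos hb (k + 2))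
  choose M hM using fun k => exists_nat_one_div_lt (hη0 k)
  let S : CantorData d := ⟨fun k => |α (m k)|, hb, U, V, M⟩
  refine ⟨S.limitSet, S.isCompact_limitSet, S.dimHausdorffMeasure_limitSet_pos hh ?_, ?_⟩
  · intro k r hr hrk
    refine hη k r hr (hrk.trans (le_trans ?_ (hM k).le))
    have h1 := S.side_succ_le k
    have h2 : S.side k / (S.M k + 1) ≤ 1 / (S.M k + 1) := by
      have := S.side_le_one k
      gcongr
    have h3 : 0 < S.side k / (S.M k + 1) := div_pos (S.side_pos k) (by positivity)
    have h4 : S.side (k + 1) ≤ 1 / (S.M k + 1) := by linarith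
    exact h4
  · rintro n _ ⟨ωA, rfl⟩ _ ⟨ωB, rfl⟩ _ ⟨ωC, rfl⟩ _ ⟨ωD, rfl⟩ htrap hdist
    obtain ⟨t, ht, heq⟩ := htrap.exists_smul_sub_eq hdist
    have hne := htrap.distinct
    simp only [List.nodup_cons, List.mem_cons, List.not_mem_nil, or_false, not_or,
      (WithLp.toLp_injective 2).eq_iff] at hne
    obtain ⟨⟨hAB, hAC, hAD⟩, ⟨hBC, hBD⟩, -⟩ := hne
    obtain ⟨U₀, V₀, h1, h2, h3, h4, h5, h6, h7, hfreq⟩ :=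
      hsep n _ _ _ _ hAB hAC hAD hBC hBD
    have hA := S.tendsto_corner ωA
    have hB := S.tendsto_corner ωB
    have hC := S.tendsto_corner ωC
    have hD := S.tendsto_corner ωD
    -- A stage handling this ratio and these balls, late enough that the four corners are separated
    -- like their limits.
    obtain ⟨k, ⟨⟨hm, rfl, rfl⟩, hk1, hk2, hk3, hk4⟩, hk5, hk6, hk7⟩ :=
      ((hfreq.and_eventually ((hA.eventually_mem h1).and ((hB.eventually_mem h2).and
        ((hC.eventually_mem h3).and (hD.eventually_mem h4))))).and_eventually
        ((hB.eventually_mem h5).and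
          ((hC.eventually_mem h6).and (hD.eventually_mem h7)))).exists
    have hi : Nonempty (Fin d) := by
      by_contra hemp
      rw [not_nonempty_iff] at hemp
      exact hAB (Subsingleton.elim _ _)
    obtain ⟨i⟩ := hi
    refine S.limitPoint_sub_ne k hk1 hk2 hk5 hk3 hk6 hk4 hk7 (t := t) ?_ i ?_
    · rw [ht, ← hm]
    · have := congrArg (fun x : EuclideanSpace ℝ (Fin d) => x i) heq
      simpa using this
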